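/- Let $\Omega\subset\mathbb{C}^n$ be a bounded domain with $C^1$ boundary, let $k_\Omega$ be its Kobayashi distance (normalized so that on the unit disc $k_\Delta(0,\zeta)=\frac12\log\frac{1+|\zeta|}{1-|\zeta|}$), let $p\in\partial\Omega$, and let $f:\Omega\to\Omega$ be holomorphic, with iterates $f^k$. For $z_0\in\Omega$ and $R>0$ define the small and big horospheres $$E_{z_0}(p,R)=\Big\{z\in\Omega:\ \limsup_{\Omega\ni w\to p}[k_\Omega(z,w)-k_\Omega(z_0,w)]<\tfrac12\log R\Big\},$$ $$F_{z_0}(p,R)=\Big\{z\in\Omega:\ \liminf_{\Omega\ni w\to p}[k_\Omega(z,w)-k_\Omega(z_0,w)]<\tfrac12\log R\Big\}.$$ Suppose that there exist $z_0\in\Omega$ and $R>0$ such that $E_{z_0}(p,R)\neq\emptyset$ and $\overline{F_{z_0}(p,R)}\cap\partial\Omega=\{p\}$. Suppose further that $f(z)=z+o(|z-p|)$ as $z\to p$ non-tangentially, i.e. for every $\alpha>0$ this holds as $z\to p$ within $\{z\in\Omega:\ |z-p|<\alpha\,\mathrm{dist}(z,\partial\Omega)\}$, and that $\{f^k\}$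 is compactly divergent, i.e. for all compact sets $K,L\subset\Omega$ one has $f^k(K)\cap L=\emptyset$ for all sufficiently large $k$. Then $f^k\to p$ uniformly on compact subsets of $\Omega$. -/

import Mathlib

open Set Filter Topology Metric Asymptotics

noncomputable section

/-- A domain in `ℂⁿ`: a nonempty connected open set. -/
def IsComplexDomain {n : ℕ} (Ω : Set (EuclideanSpace ℂ (Fin n))) : Prop :=
  IsOpen Ω ∧ IsConnected Ω

/-- `Ω` has `C¹` boundary: near each boundary point `q`, `Ω` is the sublevel set `{ρ < 0}` of a
real-valued `C¹` function `ρ` with `dρ_q ≠ 0`. -/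
def HasC1Boundary {n : ℕ} (Ω : Set (EuclideanSpace ℂ (Fin n))) : Prop :=
  ∀ q ∈ frontier Ω, ∃ (U : Set (EuclideanSpace ℂ (Fin n))) (ρ : EuclideanSpace ℂ (Fin n) → ℝ),
    IsOpen U ∧ q ∈ U ∧ ContDiffOn ℝ 1 ρ U ∧ fderiv ℝ ρ q ≠ 0 ∧
      Ω ∩ U = {z | ρ z < 0} ∩ U

/-- `f` is a holomorphic self-map of `Ω` (its values off `Ω` are irrelevant). -/
def IsHolomorphicSelfMap {n : ℕ} (Ω : Set (EuclideanSpace ℂ (Fin n)))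
    (f : EuclideanSpace ℂ (Fin n) → EuclideanSpace ℂ (Fin n)) : Prop :=
  DifferentiableOn ℂ f Ω ∧ MapsTo f Ω Ω

/-- The Poincaré distance `½ log ((1 + t) / (1 - t))`, `t = |(a - b) / (1 - b̄ a)|`, of two points
`a`, `b` of the open unit disc. -/
def poincareDist (a b : ℂ) : ℝ :=
  1 / 2 * Real.log ((1 + ‖(a - b) / (1 - starRingEnd ℂ b * a)‖) /
    (1 - ‖(a - b) / (1 - starRingEnd ℂ b * a)‖))

/-- `L` is the length of a chain of holomorphic discs in `Ω` joining `z` to `w`: there are points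
`z = x₀, …, x_m = w`, holomorphic maps `φ_i` from the unit disc to `Ω` and points `a_i`, `b_i` of
the disc with `φ_i(a_i) = x_i`, `φ_i(b_i) = x_{i+1}`, and `L` is the sum of the Poincaré distances
of `a_i` and `b_i`. -/
def IsDiscChainLength {n : ℕ} (Ω : Set (EuclideanSpace ℂ (Fin n)))
    (z w : EuclideanSpace ℂ (Fin n)) (L : ℝ) : Prop :=
  ∃ (m : ℕ) (x : ℕ → EuclideanSpace ℂ (Fin n)) (φ : ℕ → ℂ → EuclideanSpace ℂ (Fin n))
    (a b : ℕ → ℂ),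
    x 0 = z ∧ x m = w ∧
    (∀ i < m, DifferentiableOn ℂ (φ i) (ball 0 1) ∧ MapsTo (φ i) (ball 0 1) Ω ∧
      a i ∈ ball (0 : ℂ) 1 ∧ b i ∈ ball (0 : ℂ) 1 ∧ φ i (a i) = x i ∧ φ i (b i) = x (i + 1)) ∧
    L = ∑ i ∈ Finset.range m, poincareDist (a i) (b i)

/-- The Kobayashi distance `k_Ω(z, w)` of two points of a domain `Ω`: the infimum of the lengths
of chains of holomorphic discs in `Ω` joining `z` to `w`. -/
def kobayashiDist {n : ℕ} (Ω : Set (EuclideanSpace ℂ (Fin n)))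
    (z w : EuclideanSpace ℂ (Fin n)) : ℝ :=
  sInf {L | IsDiscChainLength Ω z w L}

/-- The small horosphere `E_{z₀}(p, R)`. The upper limit is taken in `[-∞, ∞]`, along `w → p` with
`w ∈ Ω`. -/
def smallHorosphere {n : ℕ} (Ω : Set (EuclideanSpace ℂ (Fin n)))
    (z₀ p : EuclideanSpace ℂ (Fin n)) (R : ℝ) : Set (EuclideanSpace ℂ (Fin n)) :=
  {z | z ∈ Ω ∧
    limsup (fun w => ((kobayashiDist Ω z w - kobayashiDist Ω z₀ w : ℝ) : EReal)) (𝓝[Ω] p) <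
      ((1 / 2 * Real.log R : ℝ) : EReal)}

/-- The big horosphere `F_{z₀}(p, R)`. The lower limit is taken in `[-∞, ∞]`, along `w → p` with
`w ∈ Ω`. -/
def bigHorosphere {n : ℕ} (Ω : Set (EuclideanSpace ℂ (Fin n)))
    (z₀ p : EuclideanSpace ℂ (Fin n)) (R : ℝ) : Set (EuclideanSpace ℂ (Fin n)) :=
  {z | z ∈ Ω ∧
    liminf (fun w => ((kobayashiDist Ω z w - kobayashiDist Ω z₀ w : ℝ) : EReal)) (𝓝[Ω] p) <
      ((1 / 2 * Real.log R : ℝ) : EReal)}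

/-- The non-tangential approach region `{z ∈ Ω : |z - p| < α dist(z, ∂Ω)}` at `p` of aperture
`α`. -/
def approachRegion {n : ℕ} (Ω : Set (EuclideanSpace ℂ (Fin n)))
    (p : EuclideanSpace ℂ (Fin n)) (α : ℝ) : Set (EuclideanSpace ℂ (Fin n)) :=
  {z | z ∈ Ω ∧ ‖z - p‖ < α * infDist z (frontier Ω)}

/-- `f(z) = z + o(|z - p|)` as `z → p` non-tangentially, that is, within each non-tangential
approach region at `p`. -/
def IsNontangentiallyTangentToId {n : ℕ} (Ω : Set (EuclideanSpace ℂ (Fin n)))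
    (p : EuclideanSpace ℂ (Fin n))
    (f : EuclideanSpace ℂ (Fin n) → EuclideanSpace ℂ (Fin n)) : Prop :=
  ∀ α : ℝ, (fun z => f z - z) =o[𝓝[approachRegion Ω p α] p] (fun z => ‖z - p‖)

/-- A sequence of self-maps of `Ω` is compactly divergent: for all compact `K, L ⊆ Ω`, the image
of `K` under all but finitely many of the maps does not meet `L`. -/
def IsCompactlyDivergent {n : ℕ} (Ω : Set (EuclideanSpace ℂ (Fin n)))
    (g : ℕ → EuclideanSpace ℂ (Fin n) → EuclideanSpace ℂ (Fin n)) : Prop :=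
  ∀ K L : Set (EuclideanSpace ℂ (Fin n)), IsCompact K → K ⊆ Ω → IsCompact L → L ⊆ Ω →
    ∀ᶠ k in atTop, Disjoint (g k '' K) L

end

/-! The key point is that every iterate maps the small horosphere E at `p` into the big one F. The
C¹ boundary gives a ray `w = p + t • v` around which Ω contains balls of radius comparable to `t`.
Tangency moves `w` by only o(t), so `k(f w, w) → 0` along the ray, and `k(f^m w, w) ≤ m k(f w, w) →
0` for each fixed `m`. Contraction then gives `k(f^m z, w) ≤ k(z, w) + o(1)` there. Control along
one ray bounds a liminf but not a limsup, hence E into F (`iterate_mem_bigHorosphere`).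

By compact divergence, orbits from E accumulate only on the boundary, hence only at `p`. Since E is
open and nonempty and the iterates are uniformly bounded, a Vitali-type argument
(`tendstoLocallyUniformlyOn_zero_of_eventually`) spreads the convergence to all of Ω. -/

/-! ### Disc chains and the Kobayashi distance. -/

section KobayashiDistance

variable {n : ℕ} {Ω : Set (EuclideanSpace ℂ (Fin n))} {x y z w : EuclideanSpace ℂ (Fin n)}

/-- No disc hypothesis is needed: `Real.log` sees only absolute values, and `t = 1` gives `log 0 =
0`. -/
theorem poincareDist_nonneg (a b : ℂ) : 0 ≤ poincareDist a b := by
  unfold poincareDist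
  have key : ∀ t : ℝ, 0 ≤ t → 0 ≤ Real.log ((1 + t) / (1 - t)) := by
    intro t ht
    rcases eq_or_ne t 1 with rfl | h1
    · simp
    · rw [← Real.log_abs]
      apply Real.log_nonneg
      rw [abs_div, le_div_iff₀ (abs_pos.2 (sub_ne_zero.2 h1.symm)), one_mul,
        abs_of_nonneg (by linarith : (0 : ℝ) ≤ 1 + t)]
      exact abs_le.2 ⟨by linarith, by linarith⟩
  have := key _ (norm_nonneg ((a - b) / (1 - starRingEnd ℂ b * a)))
  positivity

theorem IsDiscChainLength.nonneg {L : ℝ} (h : IsDiscChainLength Ω z w L) : 0 ≤ L := by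
  obtain ⟨m, x, φ, a, b, -, -, -, rfl⟩ := h
  exact Finset.sum_nonneg fun i _ => poincareDist_nonneg _ _

theorem IsDiscChainLength.refl (z : EuclideanSpace ℂ (Fin n)) : IsDiscChainLength Ω z z 0 :=
  ⟨0, fun _ => z, fun _ _ => z, fun _ => 0, fun _ => 0, rfl, rfl, by simp, by simp⟩

theorem IsDiscChainLength.trans {L₁ L₂ : ℝ} (h₁ : IsDiscChainLength Ω x y L₁)
    (h₂ : IsDiscChainLength Ω y z L₂) : IsDiscChainLength Ω x z (L₁ + L₂) := by
  obtain ⟨m₁, x₁, φ₁, a₁, b₁, hx₁, hy₁, hc₁, rfl⟩ := h₁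
  obtain ⟨m₂, x₂, φ₂, a₂, b₂, hx₂, hy₂, hc₂, rfl⟩ := h₂
  refine ⟨m₁ + m₂, fun i => if i < m₁ then x₁ i else x₂ (i - m₁),
    fun i => if i < m₁ then φ₁ i else φ₂ (i - m₁),
    fun i => if i < m₁ then a₁ i else a₂ (i - m₁),
    fun i => if i < m₁ then b₁ i else b₂ (i - m₁), ?_, ?_, ?_, ?_⟩
  · rcases Nat.eq_zero_or_pos m₁ with rfl | h
    · simp [hx₂, ← hy₁, hx₁]
    · simp [h, hx₁]
  · simp [hy₂]
  · intro i hi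
    by_cases h : i < m₁
    · obtain ⟨h1, h2, h3, h4, h5, h6⟩ := hc₁ i h
      simp only [h, if_true]
      refine ⟨h1, h2, h3, h4, h5, h6.trans ?_⟩
      by_cases h' : i + 1 < m₁
      · simp [h']
      · have : i + 1 = m₁ := by omega
        simp [this, hx₂, hy₁]
    · have h' : ¬ i + 1 < m₁ := by omega
      have h'' : i + 1 - m₁ = i - m₁ + 1 := by omega
      simpa only [h, h', if_false, h''] using hc₂ (i - m₁) (by omega)
  · rw [Finset.sum_range_add]
    congr 1
    · refine Finset.sum_congr rfl fun i hi => ?_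
      simp [Finset.mem_range.1 hi]
    · simp

theorem isDiscChainLength_of_disc {φ : ℂ → EuclideanSpace ℂ (Fin n)} {a b : ℂ}
    (hd : DifferentiableOn ℂ φ (ball 0 1)) (hm : MapsTo φ (ball 0 1) Ω)
    (ha : a ∈ ball (0 : ℂ) 1) (hb : b ∈ ball (0 : ℂ) 1) :
    IsDiscChainLength Ω (φ a) (φ b) (poincareDist a b) :=
  ⟨1, fun i => if i = 0 then φ a else φ b, fun _ => φ, fun _ => a, fun _ => b, by simp, by simp,
    fun i hi => by
      obtain rfl : i = 0 := by omega
      simp [hd, hm, mem_ball_zero_iff.1 ha, mem_ball_zero_iff.1 hb], by simp⟩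

/-- Two points of a ball contained in `Ω`, one of them the centre, lie on an affine disc. -/
theorem exists_affine_disc {r : ℝ} (hr : ball x r ⊆ Ω) (hy : ‖y - x‖ < r) :
    ∃ φ : ℂ → EuclideanSpace ℂ (Fin n), DifferentiableOn ℂ φ (ball 0 1) ∧
      MapsTo φ (ball 0 1) Ω ∧ φ 0 = x ∧ φ ((‖y - x‖ / r : ℝ) : ℂ) = y ∧
      ((‖y - x‖ / r : ℝ) : ℂ) ∈ ball (0 : ℂ) 1 := by
  have hr0 : 0 < r := (norm_nonneg _).trans_lt hy
  -- If `y = x`, then `r / 0 = 0` and the disc is constant.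
  refine ⟨fun ζ => x + ζ • (((r / ‖y - x‖ : ℝ) : ℂ) • (y - x)), by fun_prop, ?_, by simp, ?_, ?_⟩
  · intro ζ hζ
    apply hr
    rw [mem_ball_zero_iff] at hζ
    rw [mem_ball_iff_norm, add_sub_cancel_left, norm_smul, norm_smul, Complex.norm_real,
      Real.norm_of_nonneg (by positivity)]
    have : r / ‖y - x‖ * ‖y - x‖ ≤ r := by
      rcases eq_or_ne ‖y - x‖ 0 with h | h
      · simpa [h] using hr0.le
      · rw [div_mul_cancel₀ _ h]
    calc ‖ζ‖ * (r / ‖y - x‖ * ‖y - x‖) ≤ ‖ζ‖ * r := by gcongr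
      _ < r := by nlinarith
  · rcases eq_or_ne (y - x) 0 with h | h
    · simp [sub_eq_zero.1 h]
    · have h' : ‖y - x‖ ≠ 0 := norm_ne_zero_iff.2 h
      simp only [smul_smul, ← Complex.ofReal_mul]
      rw [show ‖y - x‖ / r * (r / ‖y - x‖) = 1 by field_simp]
      simp
  · rw [mem_ball_zero_iff, Complex.norm_real, Real.norm_of_nonneg (by positivity)]
    exact (div_lt_one hr0).2 hy

/-- Affine discs in small balls make the set of reachable points open and relatively closed, so
connectedness applies. This keeps the infimum defining `kobayashiDist` from being over an empty set.
-/
theorem exists_isDiscChainLength (hΩ : IsComplexDomain Ω) (hz : z ∈ Ω) (hw : w ∈ Ω) :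
    ∃ L, IsDiscChainLength Ω z w L := by
  have hopen := hΩ.1
  let A : Set (EuclideanSpace ℂ (Fin n)) := {y | y ∈ Ω ∧ ∃ L, IsDiscChainLength Ω z y L}
  have hA : IsOpen A := by
    rw [Metric.isOpen_iff]
    rintro y ⟨hy, L, hL⟩
    obtain ⟨r, hr0, hr⟩ := Metric.isOpen_iff.1 hopen y hy
    refine ⟨r, hr0, fun y' hy' => ⟨hr hy', ?_⟩⟩
    obtain ⟨φ, hd, hm, h0, h1, hb⟩ := exists_affine_disc hr (mem_ball_iff_norm.1 hy')
    have h := isDiscChainLength_of_disc hd hm (mem_ball_self one_pos) hb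
    rw [h0, h1] at h
    exact ⟨_, hL.trans h⟩
  refine (hΩ.2.isPreconnected.subset_of_closure_inter_subset hA ⟨z, hz, hz, 0, .refl z⟩ ?_ hw).2
  rintro y ⟨hyA, hy⟩
  obtain ⟨r, hr0, hr⟩ := Metric.isOpen_iff.1 hopen y hy
  obtain ⟨y', ⟨-, L, hL⟩, hyy'⟩ := Metric.mem_closure_iff.1 hyA r hr0
  obtain ⟨φ, hd, hm, h0, h1, hb⟩ :=
    exists_affine_disc hr (mem_ball_iff_norm.1 (mem_ball'.2 hyy'))
  have h := isDiscChainLength_of_disc hd hm hb (mem_ball_self one_pos)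
  rw [h0, h1] at h
  exact ⟨hy, _, hL.trans h⟩

theorem kobayashiDist_le {L : ℝ} (h : IsDiscChainLength Ω z w L) : kobayashiDist Ω z w ≤ L :=
  csInf_le ⟨0, fun _ h => h.nonneg⟩ h

theorem kobayashiDist_triangle (hΩ : IsComplexDomain Ω) (hx : x ∈ Ω) (hy : y ∈ Ω) (hz : z ∈ Ω) :
    kobayashiDist Ω x z ≤ kobayashiDist Ω x y + kobayashiDist Ω y z := by
  refine le_of_forall_pos_le_add fun ε hε => ?_
  obtain ⟨L₁, h₁, hL₁⟩ := exists_lt_of_csInf_lt (exists_isDiscChainLength hΩ hx hy)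
    (lt_add_of_pos_right (kobayashiDist Ω x y) (half_pos hε))
  obtain ⟨L₂, h₂, hL₂⟩ := exists_lt_of_csInf_lt (exists_isDiscChainLength hΩ hy hz)
    (lt_add_of_pos_right (kobayashiDist Ω y z) (half_pos hε))
  have := kobayashiDist_le (IsDiscChainLength.trans h₁ h₂)
  linarith

/-- Holomorphic self-maps contract the Kobayashi distance. -/
theorem kobayashiDist_map_le (hΩ : IsComplexDomain Ω)
    {f : EuclideanSpace ℂ (Fin n) → EuclideanSpace ℂ (Fin n)} (hf : IsHolomorphicSelfMap Ω f)
    (hz : z ∈ Ω) (hw : w ∈ Ω) :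
    kobayashiDist Ω (f z) (f w) ≤ kobayashiDist Ω z w := by
  refine le_csInf (exists_isDiscChainLength hΩ hz hw) ?_
  rintro L ⟨m, x, φ, a, b, hx, hy, hc, rfl⟩
  refine kobayashiDist_le ⟨m, fun i => f (x i), fun i => f ∘ φ i, a, b, by simp [hx],
    by simp [hy], fun i hi => ?_, rfl⟩
  obtain ⟨h1, h2, h3, h4, h5, h6⟩ := hc i hi
  exact ⟨hf.1.comp h1 h2, hf.2.comp h2, h3, h4, by simp [h5], by simp [h6]⟩

/-- The Kobayashi distance from the centre of a ball in `Ω` is controlled by the relative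
Euclidean distance. -/
theorem exists_kobayashiDist_lt {ε : ℝ} (hε : 0 < ε) :
    ∃ δ > 0, ∀ (x y : EuclideanSpace ℂ (Fin n)) (r : ℝ), 0 < r → ball x r ⊆ Ω →
      ‖y - x‖ < δ * r → kobayashiDist Ω y x < ε := by
  have hcont : ContinuousAt (fun t : ℝ => 1 / 2 * Real.log ((1 + t) / (1 - t))) 0 := by
    refine continuousAt_const.mul (ContinuousAt.log ?_ (by norm_num))
    exact (by fun_prop : ContinuousAt (fun t : ℝ => 1 + t) 0).div (by fun_prop) (by norm_num)
  obtain ⟨δ, hδ, h⟩ := Metric.continuousAt_iff.1 hcont ε hε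
  refine ⟨min δ 1, lt_min hδ one_pos, fun x y r hr hball hy => ?_⟩
  have hy1 : ‖y - x‖ < r := hy.trans_le (by nlinarith [min_le_right δ 1])
  have ht : ‖y - x‖ / r < δ :=
    ((div_lt_iff₀ hr).2 hy).trans_le (min_le_left _ _)
  have ht0 : 0 ≤ ‖y - x‖ / r := by positivity
  obtain ⟨φ, hd, hm, h0, h1, hb⟩ := exists_affine_disc hball hy1
  have hL := kobayashiDist_le (isDiscChainLength_of_disc hd hm hb (mem_ball_self one_pos))
  rw [h0, h1] at hL
  refine hL.trans_lt ?_
  have := h (x := ‖y - x‖ / r) (by rwa [Real.dist_eq, sub_zero, abs_of_nonneg ht0])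
  rw [Real.dist_eq] at this
  have h2 := (abs_lt.1 this).2
  unfold poincareDist
  simp only [sub_zero, map_zero, zero_mul, div_one, Complex.norm_real, Real.norm_of_nonneg ht0]
  simpa using h2

end KobayashiDistance

/-! ### Vitali-type convergence for bounded holomorphic maps. -/

section BoundedConvergence

variable {E F : Type*} [NormedAddCommGroup E] [NormedSpace ℂ E] [NormedAddCommGroup F]
  [NormedSpace ℂ F]

/-- Pointwise convergence of uniformly bounded holomorphic maps is locally uniform. -/
theorem tendstoLocallyUniformlyOn_zero_of_bounded {U : Set E} {g : ℕ → E → F} {M : ℝ}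
    (hU : IsOpen U) (hd : ∀ k, DifferentiableOn ℂ (g k) U) (hM : ∀ k, ∀ z ∈ U, ‖g k z‖ ≤ M)
    (hg : ∀ z ∈ U, Tendsto (fun k => g k z) atTop (𝓝 0)) :
    TendstoLocallyUniformlyOn g 0 atTop U := by
  rw [Metric.tendstoLocallyUniformlyOn_iff]
  intro ε hε x hx
  obtain ⟨r, hr0, hr⟩ := Metric.isOpen_iff.1 hU x hx
  have hM0 : 0 ≤ M := (norm_nonneg _).trans (hM 0 x hx)
  have hC : 0 < 2 * M / r + 1 := by positivity
  -- The Schwarz lemma makes every `g k` Lipschitz at `x` with constant `2 * M / r`; the `+ 1`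
  -- covers `M = 0`.
  refine ⟨ball x (min r (ε / 2 / (2 * M / r + 1))),
    mem_nhdsWithin_of_mem_nhds (ball_mem_nhds _ (by positivity)), ?_⟩
  filter_upwards [(hg x hx).norm.eventually_lt_const (show ‖(0 : F)‖ < ε / 2 by simpa using hε)]
    with k hk y hy
  have hyr : y ∈ ball x r := ball_subset_ball (min_le_left _ _) hy
  have hyd : dist y x < ε / 2 / (2 * M / r + 1) :=
    (mem_ball.1 hy).trans_le (min_le_right _ _)
  have hlip : dist (g k y) (g k x) ≤ 2 * M / r * dist y x := by
    refine Complex.dist_le_div_mul_dist_of_mapsTo_ball ((hd k).mono hr) (fun z hz => ?_) hyr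
    rw [mem_closedBall, dist_eq_norm]
    have := norm_sub_le (g k z) (g k x)
    linarith [hM k z (hr hz), hM k x hx]
  have h1 : 2 * M / r * dist y x ≤ ε / 2 := by
    rw [lt_div_iff₀ hC] at hyd
    nlinarith [dist_nonneg (x := y) (y := x)]
  have h2 : ‖g k y‖ ≤ ‖g k x‖ + dist (g k y) (g k x) := by
    rw [dist_eq_norm]
    have := norm_add_le (g k x) (g k y - g k x)
    simpa using this
  rw [Pi.zero_apply, dist_zero_left]
  linarith

/-- Bounded holomorphic functions on the unit disc that tend to zero pointwise near the origin
tend to zero pointwise on the whole disc. -/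
theorem tendsto_zero_on_disc_of_bounded [CompleteSpace F] {h : ℕ → ℂ → F} {M s : ℝ} (hs : 0 < s)
    (hs1 : s ≤ 1) (hd : ∀ k, DifferentiableOn ℂ (h k) (ball 0 1))
    (hM : ∀ k, ∀ z ∈ ball (0 : ℂ) 1, ‖h k z‖ ≤ M)
    (hh : ∀ z ∈ ball (0 : ℂ) s, Tendsto (fun k => h k z) atTop (𝓝 0)) {z : ℂ}
    (hz : z ∈ ball (0 : ℂ) 1) : Tendsto (fun k => h k z) atTop (𝓝 0) := by
  have hsub : ball (0 : ℂ) s ⊆ ball 0 1 := ball_subset_ball hs1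
  -- All Taylor coefficients at 0 tend to zero; Cauchy's estimates on a circle of radius `r > ‖z‖`
  -- then dominate the series.
  have hder : ∀ j : ℕ, (∀ k, DifferentiableOn ℂ (iteratedDeriv j (h k)) (ball 0 s)) ∧
      TendstoLocallyUniformlyOn (fun k => iteratedDeriv j (h k)) 0 atTop (ball 0 s) := by
    intro j
    induction j with
    | zero =>
      simp only [iteratedDeriv_zero]
      exact ⟨fun k => (hd k).mono hsub, tendstoLocallyUniformlyOn_zero_of_bounded isOpen_ball
        (fun k => (hd k).mono hsub) (fun k z hz => hM k z (hsub hz)) hh⟩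
    | succ j ih =>
      simp only [iteratedDeriv_succ]
      refine ⟨fun k => (ih.1 k).deriv isOpen_ball, ?_⟩
      have := ih.2.deriv (Eventually.of_forall ih.1) isOpen_ball
      have h0 : deriv (0 : ℂ → F) = 0 := by
        ext x
        exact deriv_const x (0 : F)
      rwa [h0] at this
  obtain ⟨r, hzr, hr1⟩ := exists_between (mem_ball_zero_iff.1 hz)
  have hr0 : 0 < r := (norm_nonneg z).trans_lt hzr
  have hrsub : closedBall (0 : ℂ) r ⊆ ball 0 1 := closedBall_subset_ball hr1
  have key := tendsto_tsum_of_dominated_convergence (𝓕 := (atTop : Filter ℕ))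
    (f := fun k (j : ℕ) => (j.factorial : ℂ)⁻¹ • (z - 0) ^ j • iteratedDeriv j (h k) 0)
    (g := fun _ => (0 : F)) (bound := fun j : ℕ => M * (‖z‖ / r) ^ j)
    ((summable_geometric_of_lt_one (by positivity) ((div_lt_one hr0).2 hzr)).mul_left M)
    (fun j => by
      have := (hder j).2.tendsto_at (mem_ball_self hs)
      simpa using (this.const_smul ((z - 0) ^ j)).const_smul ((j.factorial : ℂ)⁻¹))
    (Eventually.of_forall fun k j => by
      have hc := Complex.norm_iteratedDeriv_le_of_forall_mem_sphere_norm_le (c := (0 : ℂ)) (R := r)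
        (C := M) (f := h k) j hr0 ((hd k).diffContOnCl_ball hrsub)
        (fun w hw => hM k w (hrsub (sphere_subset_closedBall hw)))
      rw [norm_smul, norm_smul, norm_inv, norm_pow, sub_zero, Complex.norm_natCast]
      have hj : (0 : ℝ) < j.factorial := by exact_mod_cast j.factorial_pos
      calc (j.factorial : ℝ)⁻¹ * (‖z‖ ^ j * ‖iteratedDeriv j (h k) 0‖)
          ≤ (j.factorial : ℝ)⁻¹ * (‖z‖ ^ j * (j.factorial * M / r ^ j)) := by gcongr
        _ = M * (‖z‖ / r) ^ j := by
          rw [div_pow]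
          field_simp)
  rw [tsum_zero] at key
  exact key.congr fun k => (Complex.hasSum_taylorSeries_on_ball (hd k) hz).tsum_eq

/-- Bounded holomorphic maps on a ball that tend to zero pointwise near the centre tend to zero
pointwise on the whole ball. -/
theorem tendsto_zero_on_ball_of_bounded [CompleteSpace F] {g : ℕ → E → F} {M r : ℝ} {x : E}
    (hd : ∀ k, DifferentiableOn ℂ (g k) (ball x r)) (hM : ∀ k, ∀ z ∈ ball x r, ‖g k z‖ ≤ M)
    (hg : ∀ᶠ z in 𝓝 x, Tendsto (fun k => g k z) atTop (𝓝 0)) {y : E} (hy : y ∈ ball x r) :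
    Tendsto (fun k => g k y) atTop (𝓝 0) := by
  rcases eq_or_ne y x with rfl | hyx
  · exact hg.self_of_nhds
  have hr0 : 0 < r := pos_of_mem_ball hy
  have hn : 0 < ‖y - x‖ := norm_pos_iff.2 (sub_ne_zero.2 hyx)
  let v : E := ((r / ‖y - x‖ : ℝ) : ℂ) • (y - x)
  have hv : ‖v‖ = r := by
    rw [norm_smul, Complex.norm_real, Real.norm_of_nonneg (by positivity), div_mul_cancel₀ _ hn.ne']
  have hmaps : MapsTo (fun ζ : ℂ => x + ζ • v) (ball 0 1) (ball x r) := by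
    intro ζ hζ
    rw [mem_ball_zero_iff] at hζ
    rw [mem_ball_iff_norm, add_sub_cancel_left, norm_smul, hv]
    nlinarith
  obtain ⟨s, hs0, hs⟩ := Metric.eventually_nhds_iff_ball.1 hg
  have hcont : ContinuousAt (fun ζ : ℂ => x + ζ • v) 0 := by fun_prop
  have hcont' : ∀ᶠ ζ in 𝓝 (0 : ℂ), x + ζ • v ∈ ball x s :=
    hcont (by simpa using ball_mem_nhds x hs0)
  obtain ⟨δ, hδ0, hδ⟩ := Metric.eventually_nhds_iff_ball.1 hcont'
  have hζ : ((‖y - x‖ / r : ℝ) : ℂ) ∈ ball (0 : ℂ) 1 := by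
    rw [mem_ball_zero_iff, Complex.norm_real, Real.norm_of_nonneg (by positivity)]
    exact (div_lt_one hr0).2 (mem_ball_iff_norm.1 hy)
  have key := tendsto_zero_on_disc_of_bounded (h := fun k ζ => g k (x + ζ • v))
    (lt_min hδ0 one_pos) (min_le_right δ 1)
    (fun k => (hd k).comp (by fun_prop) hmaps) (fun k ζ hζ => hM k _ (hmaps hζ))
    (fun ζ hζ => hs _ (hδ ζ (ball_subset_ball (min_le_left _ _) hζ))) hζ
  have hyv : x + ((‖y - x‖ / r : ℝ) : ℂ) • v = y := by
    simp only [v, smul_smul, ← Complex.ofReal_mul]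
    rw [show ‖y - x‖ / r * (r / ‖y - x‖) = 1 by field_simp]
    simp
  simpa only [hyv] using key

/-- Uniformly bounded holomorphic maps on a connected open set that tend to zero pointwise near
one point tend to zero locally uniformly. -/
theorem tendstoLocallyUniformlyOn_zero_of_eventually [CompleteSpace F] {U : Set E}
    {g : ℕ → E → F} {M : ℝ} (hU : IsOpen U) (hc : IsPreconnected U)
    (hd : ∀ k, DifferentiableOn ℂ (g k) U) (hM : ∀ k, ∀ z ∈ U, ‖g k z‖ ≤ M) {x : E} (hx : x ∈ U)
    (hg : ∀ᶠ z in 𝓝 x, Tendsto (fun k => g k z) atTop (𝓝 0)) :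
    TendstoLocallyUniformlyOn g 0 atTop U := by
  refine tendstoLocallyUniformlyOn_zero_of_bounded hU hd hM fun z hz => ?_
  let A : Set E := {x | ∀ᶠ z in 𝓝 x, Tendsto (fun k => g k z) atTop (𝓝 0)}
  suffices h : U ⊆ A from (h hz).self_of_nhds
  refine hc.subset_of_closure_inter_subset isOpen_setOfPred_eventually_nhds ⟨x, hx, hg⟩ ?_
  rintro y ⟨hyA, hy⟩
  obtain ⟨r, hr0, hr⟩ := Metric.isOpen_iff.1 hU y hy
  obtain ⟨a, ha, hya⟩ := Metric.mem_closure_iff.1 hyA (r / 2) (half_pos hr0)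
  have hsub : ball a (r / 2) ⊆ U := (ball_subset_ball' (by rw [dist_comm]; linarith)).trans hr
  filter_upwards [isOpen_ball.mem_nhds (mem_ball.2 hya)] with w hw
  exact tendsto_zero_on_ball_of_bounded (fun k => (hd k).mono hsub)
    (fun k z hz => hM k z (hsub hz)) ha hw

end BoundedConvergence

/-! ### Boundary cones, horospheres and orbits. -/

section Horospheres

variable {n : ℕ} {Ω : Set (EuclideanSpace ℂ (Fin n))} {p z z₀ : EuclideanSpace ℂ (Fin n)}
  {f : EuclideanSpace ℂ (Fin n) → EuclideanSpace ℂ (Fin n)}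

/-- A set with `C¹` boundary contains an open cone with vertex at any given boundary point. -/
theorem HasC1Boundary.exists_cone (hC1 : HasC1Boundary Ω) (hp : p ∈ frontier Ω) :
    ∃ (v : EuclideanSpace ℂ (Fin n)) (c : ℝ), 0 < c ∧
      ∀ᶠ t : ℝ in 𝓝[>] 0, ball (p + t • v) (c * t) ⊆ Ω := by
  obtain ⟨U, ρ, hU, hpU, hρ, hne, heq⟩ := hC1 p hp
  have hdiff : DifferentiableAt ℝ ρ p :=
    (hρ.differentiableOn one_ne_zero).differentiableAt (hU.mem_nhds hpU)
  have hρp : ρ p ≤ 0 := by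
    by_contra! hpos
    have h1 : ∀ᶠ x in 𝓝 p, 0 < ρ x := hdiff.continuousAt.eventually_const_lt hpos
    obtain ⟨x, ⟨h0, hxU⟩, hxΩ⟩ := mem_closure_iff_nhds.1 (frontier_subset_closure hp) _
      (h1.and (hU.mem_nhds hpU))
    have : x ∈ {z | ρ z < 0} ∩ U := heq ▸ ⟨hxΩ, hxU⟩
    exact absurd this.1 (not_lt.2 (le_of_lt h0))
  obtain ⟨v, hv⟩ : ∃ v, fderiv ℝ ρ p v = -1 := by
    obtain ⟨u, hu⟩ := DFunLike.ne_iff.1 hne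
    rw [zero_apply] at hu
    exact ⟨(-(fderiv ℝ ρ p u)⁻¹) • u, by simp [hu]⟩
  set T := fderiv ℝ ρ p with hT
  -- `c` and `ε` make the deviation from the axis and the Taylor error at most `t / 4` each, against
  -- the main term `-t`.
  let c : ℝ := (4 * (‖T‖ + 1))⁻¹
  have hc : 0 < c := by positivity
  have hTc : ‖T‖ * c ≤ 1 / 4 := by
    rw [← div_eq_mul_inv, div_le_iff₀ (by positivity)]
    linarith
  let ε : ℝ := (4 * (‖v‖ + c))⁻¹
  have hε : 0 < ε := by positivity
  have hεv : ε * (‖v‖ + c) = 1 / 4 := by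
    simp only [ε]
    have : ‖v‖ + c ≠ 0 := by positivity
    field_simp
  have hlin : ∀ᶠ x in 𝓝 p, ‖ρ x - ρ p - T (x - p)‖ ≤ ε * ‖x - p‖ :=
    hdiff.hasFDerivAt.isLittleO.bound hε
  obtain ⟨δ, hδ, hball⟩ := Metric.eventually_nhds_iff_ball.1 (hlin.and (hU.mem_nhds hpU))
  refine ⟨v, c, hc, ?_⟩
  filter_upwards [Ioo_mem_nhdsGT (show (0 : ℝ) < δ / (‖v‖ + c) by positivity)] with t ht x hx
  have ht0 := ht.1
  rw [mem_ball_iff_norm] at hx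
  have hxp : ‖x - p‖ ≤ (‖v‖ + c) * t := by
    have h := norm_add_le (x - (p + t • v)) (t • v)
    rw [norm_smul, Real.norm_of_nonneg ht0.le, show x - (p + t • v) + t • v = x - p by abel] at h
    nlinarith
  have hxδ : x ∈ ball p δ := by
    rw [mem_ball_iff_norm]
    have := (lt_div_iff₀ (by positivity)).1 ht.2
    linarith
  obtain ⟨h1, hxU⟩ := hball x hxδ
  suffices h : ρ x < 0 by
    have : x ∈ Ω ∩ U := heq ▸ ⟨h, hxU⟩
    exact this.1
  have h2 : T (x - p) = T (x - (p + t • v)) - t := by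
    rw [show x - p = (x - (p + t • v)) + t • v by abel, map_add, map_smul, hv]
    simp [sub_eq_add_neg]
  have h3 : T (x - (p + t • v)) ≤ ‖T‖ * (c * t) :=
    (le_abs_self _).trans ((T.le_opNorm _).trans (by gcongr))
  have h4 := (le_abs_self _).trans h1
  have h5 : ε * ‖x - p‖ ≤ ε * ((‖v‖ + c) * t) := by gcongr
  have h6 : ε * ((‖v‖ + c) * t) = t / 4 := by rw [← mul_assoc, hεv]; ring
  have h7 : ‖T‖ * (c * t) ≤ t / 4 := by
    rw [← mul_assoc]
    nlinarith
  linarith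

/-- An open set misses its frontier. The point `p` rules out the empty frontier, where `infDist`
would be 0. -/
theorem le_infDist_frontier (hΩ : IsOpen Ω) (hp : p ∈ frontier Ω) {r : ℝ}
    (h : ball z r ⊆ Ω) : r ≤ infDist z (frontier Ω) := by
  refine (le_infDist ⟨p, hp⟩).2 fun q hq => ?_
  by_contra! hlt
  rw [hΩ.frontier_eq] at hq
  exact hq.2 (h (mem_ball'.2 hlt))

/-- There are points of `Ω` arbitrarily close to `p` that a map tangent to the identity at `p`
moves by an arbitrarily small Kobayashi distance. -/
theorem IsNontangentiallyTangentToId.frequently_kobayashiDist_lt (hΩ : IsComplexDomain Ω)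
    (hC1 : HasC1Boundary Ω) (hp : p ∈ frontier Ω) (hfp : IsNontangentiallyTangentToId Ω p f)
    {ε : ℝ} (hε : 0 < ε) : ∃ᶠ w in 𝓝[Ω] p, kobayashiDist Ω (f w) w < ε := by
  obtain ⟨v, c, hc, hcone⟩ := hC1.exists_cone hp
  obtain ⟨δ, hδ, hk⟩ := exists_kobayashiDist_lt (Ω := Ω) hε
  let α : ℝ := (‖v‖ + 1) / c
  have hpos : ∀ᶠ t : ℝ in 𝓝[>] 0, 0 < t := eventually_mem_nhdsWithin
  have hlim : Tendsto (fun t : ℝ => p + t • v) (𝓝[>] 0) (𝓝 p) := by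
    have : ContinuousAt (fun t : ℝ => p + t • v) 0 := by fun_prop
    simpa [ContinuousAt] using this.mono_left nhdsWithin_le_nhds
  have hmem : ∀ᶠ t : ℝ in 𝓝[>] 0, p + t • v ∈ approachRegion Ω p α := by
    filter_upwards [hcone, hpos] with t ht ht0
    refine ⟨ht (mem_ball_self (by positivity)), ?_⟩
    have h := le_infDist_frontier hΩ.1 hp ht
    rw [add_sub_cancel_left, norm_smul, Real.norm_of_nonneg ht0.le]
    calc t * ‖v‖ < t * (‖v‖ + 1) := by gcongr; linarith
      _ = α * (c * t) := by simp only [α]; field_simp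
      _ ≤ α * infDist (p + t • v) (frontier Ω) := by gcongr
  -- Chosen so that the displacement is at most half of `δ * (c * t)`.
  have hη : 0 < δ * c / (2 * (‖v‖ + 1)) := by positivity
  have hsmall := (tendsto_nhdsWithin_iff.2 ⟨hlim, hmem⟩).eventually ((hfp α).bound hη)
  have hgood : ∀ᶠ t : ℝ in 𝓝[>] 0, kobayashiDist Ω (f (p + t • v)) (p + t • v) < ε := by
    filter_upwards [hcone, hpos, hsmall] with t ht ht0 hs
    refine hk _ _ (c * t) (by positivity) ht (hs.trans_lt ?_)
    rw [norm_norm, add_sub_cancel_left, norm_smul, Real.norm_of_nonneg ht0.le]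
    calc δ * c / (2 * (‖v‖ + 1)) * (t * ‖v‖) ≤ δ * c / (2 * (‖v‖ + 1)) * (t * (‖v‖ + 1)) := by
          gcongr; linarith
      _ = δ * (c * t) / 2 := by field_simp
      _ < δ * (c * t) := half_lt_self (by positivity)
  have hlimΩ : Tendsto (fun t : ℝ => p + t • v) (𝓝[>] 0) (𝓝[Ω] p) :=
    tendsto_nhdsWithin_iff.2 ⟨hlim, hmem.mono fun t ht => ht.1⟩
  exact hlimΩ.frequently hgood.frequently

theorem IsHolomorphicSelfMap.iterate (hf : IsHolomorphicSelfMap Ω f) (m : ℕ) :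
    IsHolomorphicSelfMap Ω f^[m] := by
  induction m with
  | zero => exact ⟨differentiableOn_id, mapsTo_id _⟩
  | succ m ih =>
    rw [Function.iterate_succ']
    exact ⟨hf.1.comp ih.1 ih.2, hf.2.comp ih.2⟩

/-- Each step of the orbit is no longer than the first, by contraction; sum them. -/
theorem kobayashiDist_iterate_le (hΩ : IsComplexDomain Ω) (hf : IsHolomorphicSelfMap Ω f)
    {w : EuclideanSpace ℂ (Fin n)} (hw : w ∈ Ω) (m : ℕ) :
    kobayashiDist Ω (f^[m] w) w ≤ m * kobayashiDist Ω (f w) w := by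
  induction m with
  | zero => simpa using kobayashiDist_le (IsDiscChainLength.refl (Ω := Ω) w)
  | succ m ih =>
    have h1 := kobayashiDist_triangle hΩ ((hf.iterate (m + 1)).2 hw) ((hf.iterate m).2 hw) hw
    have h2 := kobayashiDist_map_le hΩ (hf.iterate m) (hf.2 hw) hw
    rw [← Function.iterate_succ_apply] at h2
    push_cast
    linarith

/-- The iterates of a holomorphic self-map tangent to the identity at `p` map small horospheres
at `p` into big horospheres. -/
theorem iterate_mem_bigHorosphere (hΩ : IsComplexDomain Ω) (hC1 : HasC1Boundary Ω)
    (hp : p ∈ frontier Ω) (hf : IsHolomorphicSelfMap Ω f)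
    (hfp : IsNontangentiallyTangentToId Ω p f) {R : ℝ} (hz : z ∈ smallHorosphere Ω z₀ p R)
    (m : ℕ) : f^[m] z ∈ bigHorosphere Ω z₀ p R := by
  obtain ⟨hzΩ, hlt⟩ := hz
  refine ⟨(hf.iterate m).2 hzΩ, ?_⟩
  -- The gap `c' - c` absorbs the displacement of `w` under `m` iterates.
  obtain ⟨c, hc, hcR⟩ := EReal.lt_iff_exists_real_btwn.1 hlt
  obtain ⟨c', hc', hcR'⟩ := EReal.lt_iff_exists_real_btwn.1 hcR
  have hcc : 0 < c' - c := sub_pos.2 (EReal.coe_lt_coe_iff.1 hc')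
  refine lt_of_le_of_lt (liminf_le_of_frequently_le' ?_) hcR'
  have hE := eventually_lt_of_limsup_lt hc
  have hmem : ∀ᶠ w in 𝓝[Ω] p, w ∈ Ω := eventually_mem_nhdsWithin
  have hfr := hfp.frequently_kobayashiDist_lt hΩ hC1 hp
    (show 0 < (c' - c) / (m + 1) by positivity)
  refine (hfr.and_eventually (hE.and hmem)).mono ?_
  rintro w ⟨hw, hwE, hwΩ⟩
  rw [EReal.coe_lt_coe_iff] at hwE
  rw [EReal.coe_le_coe_iff]
  have h1 := kobayashiDist_triangle hΩ ((hf.iterate m).2 hzΩ) ((hf.iterate m).2 hwΩ) hwΩ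
  have h2 := kobayashiDist_map_le hΩ (hf.iterate m) hzΩ hwΩ
  have h3 := kobayashiDist_iterate_le hΩ hf hwΩ m
  rw [lt_div_iff₀ (by positivity)] at hw
  have h4 : (m : ℝ) * kobayashiDist Ω (f w) w ≤ c' - c := by
    by_cases h : 0 ≤ kobayashiDist Ω (f w) w
    · linarith
    · nlinarith [(Nat.cast_nonneg m : (0 : ℝ) ≤ m)]
  linarith

/-- Moving from `x` to `y` raises the distance to `w` by at most `k(y, x)`, uniformly in `w`. -/
theorem isOpen_smallHorosphere (hΩ : IsComplexDomain Ω) {R : ℝ} :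
    IsOpen (smallHorosphere Ω z₀ p R) := by
  rw [Metric.isOpen_iff]
  rintro x ⟨hx, hlt⟩
  obtain ⟨c, hc, hcR⟩ := EReal.lt_iff_exists_real_btwn.1 hlt
  obtain ⟨c', hc', hcR'⟩ := EReal.lt_iff_exists_real_btwn.1 hcR
  obtain ⟨r, hr0, hr⟩ := Metric.isOpen_iff.1 hΩ.1 x hx
  obtain ⟨δ, hδ, hk⟩ := exists_kobayashiDist_lt (Ω := Ω)
    (sub_pos.2 (EReal.coe_lt_coe_iff.1 hc'))
  refine ⟨min r (δ * r), by positivity, fun y hy => ?_⟩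
  have hyΩ : y ∈ Ω := hr (ball_subset_ball (min_le_left _ _) hy)
  have hyx := hk x y r hr0 hr ((mem_ball_iff_norm.1 hy).trans_le (min_le_right _ _))
  refine ⟨hyΩ, lt_of_le_of_lt (limsup_le_of_le ?_ ?_) hcR'⟩
  · isBoundedDefault
  have hmem : ∀ᶠ w in 𝓝[Ω] p, w ∈ Ω := eventually_mem_nhdsWithin
  filter_upwards [eventually_lt_of_limsup_lt hc, hmem] with w hw hwΩ
  rw [EReal.coe_lt_coe_iff] at hw
  rw [EReal.coe_le_coe_iff]
  have := kobayashiDist_triangle hΩ hyΩ hx hwΩ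
  linarith

/-- A compactly divergent orbit that stays in a set whose closure meets the boundary of `Ω` only
at `p` converges to `p`. -/
theorem IsCompactlyDivergent.tendsto_of_mem (hΩ : IsOpen Ω) (hbdd : Bornology.IsBounded Ω)
    {g : ℕ → EuclideanSpace ℂ (Fin n) → EuclideanSpace ℂ (Fin n)} (hg : IsCompactlyDivergent Ω g)
    {A : Set (EuclideanSpace ℂ (Fin n))} (hA : closure A ∩ frontier Ω ⊆ {p}) (hAΩ : A ⊆ Ω)
    (hz : z ∈ Ω) (hmem : ∀ k, g k z ∈ A) : Tendsto (fun k => g k z) atTop (𝓝 p) := by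
  have hcomp : IsCompact (closure A) := (hbdd.subset hAΩ).isCompact_closure
  refine hcomp.tendsto_nhds_of_unique_mapClusterPt
    (Eventually.of_forall fun k => subset_closure (hmem k)) fun y hy hcl => ?_
  refine hA ⟨hy, ?_⟩
  rw [hΩ.frontier_eq]
  -- A cluster point in Ω would have a compact ball in Ω visited infinitely often.
  refine ⟨closure_mono hAΩ hy, fun hyΩ => ?_⟩
  obtain ⟨r, hr0, hr⟩ := Metric.nhds_basis_closedBall.mem_iff.1 (hΩ.mem_nhds hyΩ)
  have h1 := hg {z} (closedBall y r) isCompact_singleton (singleton_subset_iff.2 hz)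
    (isCompact_closedBall y r) hr
  obtain ⟨k, hk, hd⟩ := ((mapClusterPt_iff_frequently.1 hcl _
    (closedBall_mem_nhds y hr0)).and_eventually h1).exists
  exact disjoint_left.1 hd (mem_image_of_mem _ rfl) hk

end Horospheres

theorem mainTheorem8 {n : ℕ} (Ω : Set (EuclideanSpace ℂ (Fin n)))
    (hΩ : IsComplexDomain Ω) (hbdd : Bornology.IsBounded Ω) (hC1 : HasC1Boundary Ω)
    (p : EuclideanSpace ℂ (Fin n)) (hp : p ∈ frontier Ω)
    (f : EuclideanSpace ℂ (Fin n) → EuclideanSpace ℂ (Fin n)) (hf : IsHolomorphicSelfMap Ω f)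
    (hhoro : ∃ z₀ ∈ Ω, ∃ R : ℝ, 0 < R ∧ (smallHorosphere Ω z₀ p R).Nonempty ∧
      closure (bigHorosphere Ω z₀ p R) ∩ frontier Ω = {p})
    (hfp : IsNontangentiallyTangentToId Ω p f)
    (hdiv : IsCompactlyDivergent Ω (fun k => f^[k])) :
    ∀ K : Set (EuclideanSpace ℂ (Fin n)), IsCompact K → K ⊆ Ω →
      TendstoUniformlyOn (fun k => f^[k]) (fun _ => p) atTop K := by
  intro K hK hKΩ
  obtain ⟨z₀, -, R, -, ⟨x, hx⟩, hF⟩ := hhoro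
  have hconv : ∀ z ∈ smallHorosphere Ω z₀ p R, Tendsto (fun k => f^[k] z) atTop (𝓝 p) :=
    fun z hz => hdiv.tendsto_of_mem hΩ.1 hbdd hF.subset (fun _ h => h.1) hz.1
      (iterate_mem_bigHorosphere hΩ hC1 hp hf hfp hz)
  obtain ⟨M, hM⟩ := hbdd.exists_norm_le
  have hlu := tendstoLocallyUniformlyOn_zero_of_eventually (g := fun k z => f^[k] z - p)
    (M := M + ‖p‖) hΩ.1 hΩ.2.isPreconnected (fun k => (hf.iterate k).1.sub_const p)
    (fun k z hz => (norm_sub_le _ _).trans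
      (by simpa using hM _ ((hf.iterate k).2 hz))) hx.1 (by
        filter_upwards [(isOpen_smallHorosphere hΩ).mem_nhds hx] with z hz
        simpa using (hconv z hz).sub_const p)
  have hu := (tendstoLocallyUniformlyOn_iff_tendstoUniformlyOn_of_compact hK).1 (hlu.mono hKΩ)
  rw [Metric.tendstoUniformlyOn_iff] at hu ⊢
  intro ε hε
  filter_upwards [hu ε hε] with k hk z hz
  simpa [dist_eq_norm, norm_sub_rev] using hk z hz
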